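/- **Setting.** A target $X^*\in\mathbb R^d$, $d\ge 1$, is queried in rounds $n=0,\dots,N-1$ by a controller with $M$ players. Let $p_n$ be the posterior density of $X^*$ at time $n$, and $P_n(R)=\int_R p_n$. Densities are assumed to have finite differential entropy $H(p)=-\int p\log p$. At time $n$ the controller chooses, as a function of the history $\mathcal F_n$ of past queries and responses, a tuple $\mathbf A_n=(A_n^{(1)},\dots,A_n^{(M)})$ of regions, $A_n^{(m)}$ belonging to a given nonempty class $\mathcal Q_n^{(m)}$ of measurable subsets of $\mathbb R^d$. It receives binary responses $\mathbf Y_{n+1}=(Y^{(1)}_{n+1},\dots,Y^{(M)}_{n+1})\in\{0,1\}^M$ that are conditionally independent given $X^*$: $$\mathbb P(\mathbf Y_{n+1}=\mathbf y\mid \mathbf A_n,X^*=x,\mathcal F_n)=\prod_{m=1}^M f^{(m)}_{I(x\in A_n^{(m)})}(y^{(m)}\mid A_n^{(m)},\mathcal F_n),$$ where the $f^{(m)}_j(\cdot\mid A,\mathcal F_n)$, $j\in\{0,1\}$, are known probability mass functions on $\{0,1\}$. Then $p_{n+1}$ is obtained from $p_n$ by Bayes' rule. Put $A^1=A$, $A^0=A^c$,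 $g_{i_1:i_M}(\mathbf y)=\prod_m f^{(m)}_{i_m}(y^{(m)}\mid A^{(m)},\mathcal F_n)$, and $$\phi_n(\mathbf A)=H\Big(\sum_{i\in\{0,1\}^M} g_{i}\,P_n\big(\textstyle\bigcap_m (A^{(m)})^{i_m}\big)\Big)-\sum_{i\in\{0,1\}^M}H(g_{i})\,P_n\big(\textstyle\bigcap_m (A^{(m)})^{i_m}\big),\qquad G_n^*=\sup_{\mathbf A}\phi_n(\mathbf A),$$ where $H$ of a probability mass function is its Shannon entropy and the supremum is over the admissible query tuples. For a policy $\zeta$ let $\mathbb E^\zeta$ be the expectation under the law that it induces, and let $V_n(p)=\inf_\zeta\mathbb E^\zeta[H(p_N)\mid p_n=p,\mathcal F_n]$ for $0\le n\le N$. **Theorem.** 1. For every history, posterior $p_n$ and admissible query tuple $\mathbf A$, $H(p_n)-\mathbb E[H(p_{n+1})\mid\mathbf A_n=\mathbf A,\mathcal F_n]=\phi_n(\mathbf A)$; consequently $\sup_{\mathbf A}\{H(p_n)-\mathbb E[H(p_{n+1})\mid\mathbf A_n=\mathbf A,\mathcal F_n]\}=G_n^*$, which is finite. 2. Let $n\le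 N$ and $p_n=p$, and suppose that $G^*_k$ equals one and the same number $G^*$ for all $k\in\{n,\dots,N-1\}$ and all situations (histories, with their posteriors) that can arise at time $k$ with positive probability under some policy. Then the infimum defining $V_n(p)$ is finite, $$V_n(p)=H(p)-(N-n)G^*,$$ and a policy is optimal (attains this infimum) if and only if it is greedy, i.e. at each step $k=n,\dots,N-1$, in every situation that arises under it with positive probability, its queries satisfy $\phi_k(\mathbf A_k)=G^*$; so at each such step it achieves the expected entropy loss $G^*$. 3. Suppose that the channels are memoryless and time-invariant, $f^{(m)}_j(y\mid A,\mathcal F_n)=f^{(m)}_j(y)$, and that every measurable set is an admissible query region. Then $G_n^*$ is a constant $G^*$ that depends neither on $n$, nor on the history, nor on the posterior, and the supremum that defines it is attained. Hence all conclusions of part 2 hold for all $n\le N$ and all $p$, and an optimal policy exists. -/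

import Mathlib

open MeasureTheory

noncomputable section

namespace TwentyQuestions

/-- The space `ℝ^d` in which the target lives. -/
abbrev Loc (d : ℕ) : Type := EuclideanSpace ℝ (Fin d)

/-- A batch of query regions `(A⁽¹⁾, …, A⁽ᴹ⁾)`, one for each player. -/
abbrev Queries (d M : ℕ) : Type := Fin M → Set (Loc d)

/-- The binary responses of the `M` players in one round. -/
abbrev Responses (M : ℕ) : Type := Fin M → Bool

/-- The information available to the controller after `n` rounds: the list, in chronological order,
of the `n` batches of queries asked and of the responses to them. Its length is the time `n`. -/
abbrev History (d M : ℕ) : Type := List (Queries d M × Responses M)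

/-- The players' conditional response probabilities: `f h m A j y` is the probability that
player `m` answers `y`, when the history is `h`, the player is asked the region `A`, and the truth
value of `X* ∈ A` is `j`. -/
abbrev Channel (d M : ℕ) : Type :=
  History d M → Fin M → Set (Loc d) → Bool → Bool → ℝ

/-- Every `f h m A j` is a probability mass function on `{0, 1}`. -/
def IsChannel {d M : ℕ} (f : Channel d M) : Prop :=
  ∀ h m A j, (∀ y, 0 ≤ f h m A j y) ∧ ∑ y, f h m A j y = 1

/-- The response probabilities depend neither on the history nor on the region that is asked. -/
def IsMemoryless {d M : ℕ} (f : Channel d M) : Prop :=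
  ∀ h h' m A A', f h m A = f h' m A'

/-- A probability density on `ℝ^d` whose differential entropy is finite. -/
structure IsDensity {d : ℕ} (p : Loc d → ℝ) : Prop where
  measurable : Measurable p
  nonneg : ∀ x, 0 ≤ p x
  integrable : Integrable p
  integral_eq_one : ∫ x, p x = 1
  integrable_entropy : Integrable fun x => p x * Real.log (p x)

/-- Differential entropy of a density. -/
def diffEntropy {d : ℕ} (p : Loc d → ℝ) : ℝ := -∫ x, p x * Real.log (p x)

/-- Shannon entropy of a probability mass function on a finite set. -/
def shannonEntropy {α : Type*} [Fintype α] (q : α → ℝ) : ℝ := -∑ y, q y * Real.log (q y)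

/-- The cell `⋂ₘ (A⁽ᵐ⁾)^{iₘ}` of the dyadic partition, with `A¹ = A` and `A⁰ = Aᶜ`. -/
def cell {d M : ℕ} (A : Queries d M) (i : Fin M → Bool) : Set (Loc d) :=
  ⋂ m, if i m = true then A m else (A m)ᶜ

/-- `g_{i₁:i_M}(y) = ∏ₘ f⁽ᵐ⁾_{iₘ}(y⁽ᵐ⁾)`. -/
def jointPMF {d M : ℕ} (f : Channel d M) (h : History d M) (A : Queries d M)
    (i : Fin M → Bool) (y : Responses M) : ℝ :=
  ∏ m, f h m (A m) (i m) (y m)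

/-- The quantity maximized by the optimal queries:
`H(∑ᵢ gᵢ P(cellᵢ)) - ∑ᵢ H(gᵢ) P(cellᵢ)`, where `P` has density `p`. -/
def gain {d M : ℕ} (f : Channel d M) (h : History d M) (p : Loc d → ℝ) (A : Queries d M) : ℝ :=
  shannonEntropy (fun y => ∑ i, jointPMF f h A i y * ∫ x in cell A i, p x)
    - ∑ i, shannonEntropy (jointPMF f h A i) * ∫ x in cell A i, p x

open Classical in
/-- `ℙ(Y_{n+1} = y | A_n = A, X* = x, F_n = h)` under conditional independence of the players. -/
def likelihood {d M : ℕ} (f : Channel d M) (h : History d M) (A : Queries d M)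
    (y : Responses M) (x : Loc d) : ℝ :=
  ∏ m, if x ∈ A m then f h m (A m) true (y m) else f h m (A m) false (y m)

/-- For a target of density `p`, the probability of an observation whose conditional
probability given `X* = x` is `L x`. -/
def evidence {d : ℕ} (p L : Loc d → ℝ) : ℝ := ∫ x, p x * L x

/-- Bayes' rule: the density of the target given an observation whose conditional
probability given `X* = x` is `L x`. -/
def bayes {d : ℕ} (p L : Loc d → ℝ) : Loc d → ℝ := fun x => p x * L x / evidence p L

/-- `𝔼[H(p_{n+1}) | A_n = A, F_n = h]`, when `p_n = p`. -/
def expectedNextEntropy {d M : ℕ} (f : Channel d M) (h : History d M) (p : Loc d → ℝ)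
    (A : Queries d M) : ℝ :=
  ∑ y, evidence p (likelihood f h A y) * diffEntropy (bayes p (likelihood f h A y))

/-- Batches of queries in which player `m` is asked a region of the class `Q n m`; `Q n m` is the
class of regions about which player `m` may be asked at time `n`. -/
abbrev Admissible {d M : ℕ} (Q : ℕ → Fin M → Set (Set (Loc d))) (n : ℕ) : Type :=
  {A : Queries d M // ∀ m, A m ∈ Q n m}

/-- The maximal one-step entropy loss `G*` at history `h` and posterior `p`. -/
def maxGain {d M : ℕ} (Q : ℕ → Fin M → Set (Set (Loc d))) (f : Channel d M) (h : History d M)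
    (p : Loc d → ℝ) : ℝ :=
  ⨆ A : Admissible Q h.length, gain f h p A.1

/-- A joint query policy chooses the next batch of admissible queries from the history. -/
abbrev Policy {d M : ℕ} (Q : ℕ → Fin M → Set (Set (Loc d))) : Type :=
  (h : History d M) → Admissible Q h.length

/-- The history that results if, starting from the history `h`, the queries are chosen by the
policy `ζ` and the successive responses are `ys`. -/
def run {d M : ℕ} {Q : ℕ → Fin M → Set (Set (Loc d))} (ζ : Policy Q) :
    History d M → List (Responses M) → History d M
  | h, [] => h
  | h, y :: ys => run ζ (h ++ [((ζ h).1, y)]) ys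

/-- The conditional probability, given `X* = x` and the history `h`, that the next responses under
the policy `ζ` are `ys`. -/
def pathLikelihood {d M : ℕ} {Q : ℕ → Fin M → Set (Set (Loc d))} (f : Channel d M)
    (ζ : Policy Q) : History d M → List (Responses M) → Loc d → ℝ
  | _, [], _ => 1
  | h, y :: ys, x =>
      likelihood f h (ζ h).1 y x * pathLikelihood f ζ (h ++ [((ζ h).1, y)]) ys x

/-- The probability of the responses `ys` under the policy `ζ`, starting from the history `h` and
the posterior `p`. -/
def pathProb {d M : ℕ} {Q : ℕ → Fin M → Set (Set (Loc d))} (f : Channel d M) (ζ : Policy Q)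
    (h : History d M) (p : Loc d → ℝ) (ys : List (Responses M)) : ℝ :=
  evidence p (pathLikelihood f ζ h ys)

/-- The posterior density after the responses `ys` under the policy `ζ`, starting from the history
`h` and the posterior `p`. -/
def posterior {d M : ℕ} {Q : ℕ → Fin M → Set (Set (Loc d))} (f : Channel d M) (ζ : Policy Q)
    (h : History d M) (p : Loc d → ℝ) (ys : List (Responses M)) : Loc d → ℝ :=
  bayes p (pathLikelihood f ζ h ys)

/-- `𝔼^ζ[H(p_N) | F_n = h, p_n = p]`, where `n` is the length of `h`. -/
def expectedFinalEntropy {d M : ℕ} {Q : ℕ → Fin M → Set (Set (Loc d))} (f : Channel d M) (N : ℕ)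
    (h : History d M) (p : Loc d → ℝ) (ζ : Policy Q) : ℝ :=
  ∑ ys : Fin (N - h.length) → Responses M,
    pathProb f ζ h p (List.ofFn ys) * diffEntropy (posterior f ζ h p (List.ofFn ys))

/-- The value function `V_n = inf_ζ 𝔼^ζ[H(p_N) | F_n = h, p_n = p]`, where `n` is the length
of `h`. -/
def value {d M : ℕ} (Q : ℕ → Fin M → Set (Set (Loc d))) (f : Channel d M) (N : ℕ)
    (h : History d M) (p : Loc d → ℝ) : ℝ :=
  ⨅ ζ : Policy Q, expectedFinalEntropy f N h p ζ

/-- The policy `ζ` minimizes the expected entropy after round `N`, starting from `h` and `p`. -/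
def IsOptimal {d M : ℕ} {Q : ℕ → Fin M → Set (Set (Loc d))} (f : Channel d M) (N : ℕ)
    (h : History d M) (p : Loc d → ℝ) (ζ : Policy Q) : Prop :=
  ∀ ζ' : Policy Q, expectedFinalEntropy f N h p ζ ≤ expectedFinalEntropy f N h p ζ'

/-- At each remaining step and in each situation that arises with positive probability, the queries
chosen by `ζ` attain the supremum that defines the maximal one-step entropy loss. -/
def IsGreedy {d M : ℕ} {Q : ℕ → Fin M → Set (Set (Loc d))} (f : Channel d M) (N : ℕ)
    (h : History d M) (p : Loc d → ℝ) (ζ : Policy Q) : Prop :=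
  ∀ ys : List (Responses M), h.length + ys.length < N → 0 < pathProb f ζ h p ys →
    gain f (run ζ h ys) (posterior f ζ h p ys) (ζ (run ζ h ys)).1
      = maxGain Q f (run ζ h ys) (posterior f ζ h p ys)

end TwentyQuestions

end

open TwentyQuestions

/-!
In one round, both expansions of the joint entropy of the target and the response give
`H(X) - H(X | Y) = H(Y) - H(Y | X)`, and the right-hand side is `φ`. Hence the expected final
entropy is `H(p)` minus the sum of the expected gains. If each maximal gain is `G`, every term is at
most `G`, with equality exactly for queries that are greedy almost surely; since the posterior is a
function of the history, a policy may choose queries whose gain is within `ε` of `G`.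

For memoryless channels the gain is the mutual information of a fixed finite channel whose input
distribution is given by the cell probabilities. A density has no atoms, so it can be cut into cells
of arbitrary prescribed probabilities. The maximal gain is therefore the capacity of that channel.
-/

noncomputable section

namespace TwentyQuestions

/-! ### Entropy and mutual information on finite alphabets -/

section FiniteAlphabet

variable {α β : Type*} [Fintype α] [Fintype β]

lemma shannonEntropy_eq_sum_negMulLog (q : α → ℝ) :
    shannonEntropy q = ∑ y, Real.negMulLog (q y) := by
  simp only [shannonEntropy, Real.negMulLog_eq_neg, Finset.sum_neg_distrib]

lemma shannonEntropy_nonneg {q : α → ℝ} (h0 : ∀ y, 0 ≤ q y) (h1 : ∀ y, q y ≤ 1) :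
    0 ≤ shannonEntropy q := by
  rw [shannonEntropy_eq_sum_negMulLog]
  exact Finset.sum_nonneg fun y _ => Real.negMulLog_nonneg (h0 y) (h1 y)

lemma shannonEntropy_le_card {q : α → ℝ} (h0 : ∀ y, 0 ≤ q y) :
    shannonEntropy q ≤ Fintype.card α := by
  rw [shannonEntropy_eq_sum_negMulLog, ← Finset.card_univ, ← nsmul_one]
  refine Finset.sum_le_card_nsmul _ _ _ fun y _ => ?_
  exact (Real.negMulLog_le_one_sub_self (h0 y)).trans (sub_le_self 1 (h0 y))

lemma continuous_shannonEntropy : Continuous (shannonEntropy : (α → ℝ) → ℝ) := by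
  simp_rw [funext shannonEntropy_eq_sum_negMulLog]
  fun_prop

/-- The mutual information between the input and the output of a channel with transition
probabilities `g` and input distribution `u`. -/
def mutualInfo (g : α → β → ℝ) (u : α → ℝ) : ℝ :=
  shannonEntropy (fun y => ∑ i, g i y * u i) - ∑ i, shannonEntropy (g i) * u i

lemma continuous_mutualInfo (g : α → β → ℝ) : Continuous (mutualInfo g) :=
  (continuous_shannonEntropy.comp (by fun_prop)).sub (by fun_prop)

lemma mutualInfo_le_card {g : α → β → ℝ} (hg0 : ∀ i y, 0 ≤ g i y) (hg1 : ∀ i y, g i y ≤ 1)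
    {u : α → ℝ} (hu : ∀ i, 0 ≤ u i) : mutualInfo g u ≤ Fintype.card β := by
  have hout : shannonEntropy (fun y => ∑ i, g i y * u i) ≤ Fintype.card β :=
    shannonEntropy_le_card fun y => Finset.sum_nonneg fun i _ => mul_nonneg (hg0 i y) (hu i)
  have hcond : 0 ≤ ∑ i, shannonEntropy (g i) * u i :=
    Finset.sum_nonneg fun i _ => mul_nonneg (shannonEntropy_nonneg (hg0 i) (hg1 i)) (hu i)
  exact (sub_le_self _ hcond).trans hout

/-- Shannon's capacity of the channel `g`: the largest mutual information over all input
distributions. -/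
def capacity (g : α → β → ℝ) : ℝ := sSup (mutualInfo g '' stdSimplex ℝ α)

lemma mutualInfo_le_capacity (g : α → β → ℝ) {u : α → ℝ} (hu : u ∈ stdSimplex ℝ α) :
    mutualInfo g u ≤ capacity g :=
  le_csSup ((isCompact_stdSimplex ℝ α).image (continuous_mutualInfo g)).bddAbove
    (Set.mem_image_of_mem _ hu)

lemma exists_mutualInfo_eq_capacity [Nonempty α] (g : α → β → ℝ) :
    ∃ u ∈ stdSimplex ℝ α, mutualInfo g u = capacity g := by
  classical
  obtain ⟨u, hu, hmax⟩ := (isCompact_stdSimplex ℝ α).exists_sSup_image_eq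
    ⟨_, single_mem_stdSimplex ℝ (Classical.arbitrary α)⟩ (continuous_mutualInfo g).continuousOn
  exact ⟨u, hu, hmax.symm⟩

end FiniteAlphabet

/-! ### Partitions with prescribed integrals -/

section Partition

variable {X : Type*} [MeasurableSpace X] {μ : Measure X} {p : X → ℝ}

lemma integral_mul_comp_eq_sum {ι : Type*} [Fintype ι] [MeasurableSpace ι]
    [MeasurableSingletonClass ι] {τ : X → ι} (hτ : Measurable τ) (hp : Integrable p μ)
    (F : ι → ℝ) : ∫ x, p x * F (τ x) ∂μ = ∑ i, F i * ∫ x in τ ⁻¹' {i}, p x ∂μ := by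
  have hfiber : ∀ i, MeasurableSet (τ ⁻¹' {i}) := fun i => hτ (measurableSet_singleton i)
  have hconst : ∀ i, Set.EqOn (fun x => p x * F (τ x)) (fun x => F i * p x) (τ ⁻¹' {i}) :=
    fun i x hx => by rw [Set.mem_preimage, Set.mem_singleton_iff] at hx; simp only [hx, mul_comm]
  have huniv : ⋃ i, τ ⁻¹' {i} = Set.univ := by
    rw [← Set.preimage_iUnion, Set.iUnion_of_singleton, Set.preimage_univ]
  rw [← setIntegral_univ, ← huniv, integral_iUnion_fintype hfiber (pairwise_disjoint_fiber τ)
    fun i => (integrableOn_congr_fun (hconst i) (hfiber i)).2 (hp.const_mul _).integrableOn]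
  exact Finset.sum_congr rfl fun i _ => by
    rw [setIntegral_congr_fun (hfiber i) (hconst i), integral_const_mul]

variable {φ : X → ℝ}

lemma continuous_setIntegral_preimage_Iic (hφ : Measurable φ) (hnull : ∀ t, μ (φ ⁻¹' {t}) = 0)
    (hp : Integrable p μ) : Continuous fun t => ∫ x in φ ⁻¹' Set.Iic t, p x ∂μ := by
  have hmeas : ∀ t, MeasurableSet (φ ⁻¹' Set.Iic t) := fun t => hφ measurableSet_Iic
  simp_rw [← integral_indicator (hmeas _)]
  refine continuous_iff_continuousAt.2 fun t₀ => continuousAt_of_dominated (bound := fun x => ‖p x‖)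
    (.of_forall fun t => (hp.indicator (hmeas t)).aestronglyMeasurable)
    (.of_forall fun t => .of_forall fun x => norm_indicator_le_norm_self _ _) hp.norm ?_
  have hne : ∀ᵐ x ∂μ, φ x ≠ t₀ := measure_eq_zero_iff_ae_notMem.1 (hnull t₀)
  filter_upwards [hne] with x hx
  have hev : ∀ᶠ t in nhds t₀, (φ x ≤ t₀ ↔ φ x ≤ t) := by
    rcases lt_or_gt_of_ne hx with hlt | hgt
    · filter_upwards [lt_mem_nhds hlt] with t ht using iff_of_true hlt.le ht.le
    · filter_upwards [gt_mem_nhds hgt] with t ht using iff_of_false hgt.not_ge ht.not_ge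
  refine (continuousAt_const (y := (φ ⁻¹' Set.Iic t₀).indicator p x)).congr ?_
  filter_upwards [hev] with t ht
  classical
  simp only [Set.indicator_apply, Set.mem_preimage, Set.mem_Iic, ht]

lemma exists_subset_setIntegral_eq (hφ : Measurable φ) (hnull : ∀ t, μ (φ ⁻¹' {t}) = 0)
    (hp : Integrable p μ) {S : Set X} (hS : MeasurableSet S) {c : ℝ} (hc0 : 0 ≤ c)
    (hc : c ≤ ∫ x in S, p x ∂μ) : ∃ T ⊆ S, MeasurableSet T ∧ ∫ x in T, p x ∂μ = c := by
  rcases hc0.eq_or_lt with rfl | hc0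
  · exact ⟨∅, Set.empty_subset S, .empty, setIntegral_empty⟩
  rcases hc.eq_or_lt with rfl | hc
  · exact ⟨S, subset_rfl, hS, rfl⟩
  have hmeas : ∀ t, MeasurableSet (φ ⁻¹' Set.Iic t) := fun t => hφ measurableSet_Iic
  have hcont : Continuous fun t => ∫ x in φ ⁻¹' Set.Iic t, p x ∂μ.restrict S :=
    continuous_setIntegral_preimage_Iic hφ
      (fun t => Measure.absolutelyContinuous_restrict (hnull t)) hp.integrableOn
  have hmono : Monotone fun t => φ ⁻¹' Set.Iic t := fun s t hst =>
    Set.preimage_mono (Set.Iic_subset_Iic.2 hst)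
  have hbot : ⋂ t, φ ⁻¹' Set.Iic (-t) = ∅ :=
    Set.eq_empty_of_forall_notMem fun x hx =>
      absurd (Set.mem_iInter.1 hx (1 - φ x)) fun h => by
        rw [Set.mem_preimage, Set.mem_Iic] at h
        linarith
  have htop : ⋃ t, φ ⁻¹' Set.Iic t = Set.univ :=
    Set.iUnion_eq_univ_iff.2 fun x => ⟨φ x, Set.mem_preimage.2 (Set.mem_Iic.2 le_rfl)⟩
  have hlim_bot := tendsto_setIntegral_of_antitone (fun t => hmeas (-t))
    (fun s t hst => hmono (neg_le_neg hst)) ⟨0, hp.restrict (s := S) |>.integrableOn⟩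
  have hlim_top := tendsto_setIntegral_of_monotone hmeas hmono
    (hp.restrict (s := S)).integrableOn
  rw [hbot, setIntegral_empty] at hlim_bot
  rw [htop, setIntegral_univ] at hlim_top
  obtain ⟨s, hs⟩ := (hlim_bot.eventually_lt_const hc0).exists
  obtain ⟨t, ht⟩ := (hlim_top.eventually_const_lt hc).exists
  obtain ⟨r, hr⟩ := mem_range_of_exists_le_of_exists_ge hcont ⟨-s, hs.le⟩ ⟨t, ht.le⟩
  refine ⟨φ ⁻¹' Set.Iic r ∩ S, Set.inter_subset_right, (hmeas r).inter hS, ?_⟩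
  rw [← Measure.restrict_restrict (hmeas r)]
  exact hr

lemma exists_measurable_setIntegral_inter_fiber_eq {ι : Type*} [Nonempty ι]
    [MeasurableSpace ι] (hφ : Measurable φ) (hnull : ∀ t, μ (φ ⁻¹' {t}) = 0)
    (hp : Integrable p μ) (s : Finset ι) {u : ι → ℝ} (hu : ∀ i, 0 ≤ u i) (hus : ∀ i ∉ s, u i = 0)
    {S : Set X} (hS : MeasurableSet S) (hsum : ∑ i ∈ s, u i = ∫ x in S, p x ∂μ) :
    ∃ τ : X → ι, Measurable τ ∧ ∀ i, ∫ x in S ∩ τ ⁻¹' {i}, p x ∂μ = u i := by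
  classical
  induction s using Finset.induction_on generalizing u S with
  | empty =>
    refine ⟨fun _ => Classical.arbitrary ι, measurable_const, fun i => ?_⟩
    rw [hus i (Finset.notMem_empty i), Set.preimage_const]
    split_ifs
    · rw [Set.inter_univ, ← hsum, Finset.sum_empty]
    · rw [Set.inter_empty, setIntegral_empty]
  | insert a s ha ih =>
    rw [Finset.sum_insert ha] at hsum
    obtain ⟨R, hRS, hR, hRu⟩ := exists_subset_setIntegral_eq hφ hnull hp hS (hu a)
      (hsum ▸ le_add_of_nonneg_right (Finset.sum_nonneg fun i _ => hu i))
    obtain ⟨τ, hτ, hτu⟩ := ih (u := Function.update u a 0) (S := S \ R)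
      (fun i => by by_cases hi : i = a <;> simp [hi, hu])
      (fun i hi => by by_cases hia : i = a <;> simp [hia, hus, hi])
      (hS.diff hR) (by
        rw [setIntegral_sdiff hR hp.integrableOn hRS, hRu, ← hsum, add_sub_cancel_left]
        exact Finset.sum_update_of_notMem ha u 0)
    refine ⟨R.piecewise (fun _ => a) τ, measurable_const.piecewise hR hτ, fun i => ?_⟩
    have hin : (S ∩ R.piecewise (fun _ => a) τ ⁻¹' {i}) ∩ R = if i = a then R else ∅ := by
      ext x
      by_cases hx : x ∈ R <;> by_cases hi : i = a <;> simp [hx, hi, @hRS x, Ne.symm]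
    have hout : (S ∩ R.piecewise (fun _ => a) τ ⁻¹' {i}) \ R = (S \ R) ∩ τ ⁻¹' {i} := by
      ext x
      by_cases hx : x ∈ R <;> simp [hx]
    rw [← integral_inter_add_sdiff hR hp.integrableOn, hin, hout, hτu]
    by_cases hi : i = a <;> simp [hi, hRu]

end Partition


/-! ### Cells and response probabilities -/

variable {d M : ℕ}

open Classical in
/-- The index of the cell of the dyadic partition generated by `A` that contains `x`. -/
def pattern (A : Queries d M) (x : Loc d) : Fin M → Bool := fun m => decide (x ∈ A m)

lemma cell_eq_preimage (A : Queries d M) (i : Fin M → Bool) : cell A i = pattern A ⁻¹' {i} := by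
  ext x
  simp only [cell, pattern, Set.mem_iInter, Set.mem_preimage, Set.mem_singleton_iff, funext_iff]
  refine forall_congr' fun m => ?_
  cases i m <;> simp

lemma measurable_pattern {A : Queries d M} (hA : ∀ m, MeasurableSet (A m)) :
    Measurable (pattern A) :=
  measurable_pi_lambda _ fun m => measurable_to_bool <| by
    convert hA m using 1
    ext x
    simp [pattern]

/-- The distribution of the index of the cell that contains a target of density `p`. -/
def cellProb (p : Loc d → ℝ) (A : Queries d M) (i : Fin M → Bool) : ℝ := ∫ x in cell A i, p x

lemma gain_eq_mutualInfo (f : Channel d M) (h : History d M) (p : Loc d → ℝ) (A : Queries d M) :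
    gain f h p A = mutualInfo (jointPMF f h A) (cellProb p A) :=
  rfl

lemma integral_mul_comp_pattern {A : Queries d M} (hA : ∀ m, MeasurableSet (A m))
    {p : Loc d → ℝ} (hp : Integrable p) (F : (Fin M → Bool) → ℝ) :
    ∫ x, p x * F (pattern A x) = ∑ i, F i * cellProb p A i := by
  simp only [cellProb, cell_eq_preimage]
  exact integral_mul_comp_eq_sum (measurable_pattern hA) hp F

lemma IsDensity.cellProb_nonneg {p : Loc d → ℝ} (hp : IsDensity p) (A : Queries d M)
    (i : Fin M → Bool) : 0 ≤ cellProb p A i :=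
  integral_nonneg hp.nonneg

lemma IsDensity.cellProb_mem_stdSimplex {p : Loc d → ℝ} (hp : IsDensity p) {A : Queries d M}
    (hA : ∀ m, MeasurableSet (A m)) : cellProb p A ∈ stdSimplex ℝ (Fin M → Bool) :=
  ⟨hp.cellProb_nonneg A, by
    simpa [hp.integral_eq_one] using (integral_mul_comp_pattern hA hp.integrable fun _ => 1).symm⟩

lemma IsDensity.exists_cellProb_eq {p : Loc d → ℝ} (hp : IsDensity p) (hd : 0 < d)
    {u : (Fin M → Bool) → ℝ} (hu : u ∈ stdSimplex ℝ (Fin M → Bool)) :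
    ∃ A : Queries d M, (∀ m, MeasurableSet (A m)) ∧ cellProb p A = u := by
  have : Nonempty (Fin d) := ⟨⟨0, hd⟩⟩
  have hsphere : ∀ t, volume (norm ⁻¹' {t} : Set (Loc d)) = 0 := fun t => by
    have hpreimage : (norm ⁻¹' {t} : Set (Loc d)) = Metric.sphere 0 t := by
      ext x
      simp
    rw [hpreimage, Measure.addHaar_sphere]
  obtain ⟨τ, hτ, hτu⟩ := exists_measurable_setIntegral_inter_fiber_eq measurable_norm hsphere
    hp.integrable Finset.univ hu.1 (fun i hi => absurd (Finset.mem_univ i) hi) .univ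
    (by rw [setIntegral_univ, hp.integral_eq_one, hu.2])
  have hpattern : pattern (fun m => {x | τ x m = true}) = τ := by
    funext x m
    simp [pattern]
  refine ⟨fun m => {x | τ x m = true}, fun m => ?_, funext fun i => ?_⟩
  · exact (measurable_pi_apply m).comp hτ (measurableSet_singleton true)
  · rw [cellProb, cell_eq_preimage, hpattern, ← hτu i, Set.univ_inter]

lemma jointPMF_nonneg {f : Channel d M} (hf : IsChannel f) (h : History d M) (A : Queries d M)
    (i : Fin M → Bool) (y : Responses M) : 0 ≤ jointPMF f h A i y :=
  Finset.prod_nonneg fun m _ => (hf h m (A m) (i m)).1 (y m)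

lemma sum_jointPMF {f : Channel d M} (hf : IsChannel f) (h : History d M) (A : Queries d M)
    (i : Fin M → Bool) : ∑ y, jointPMF f h A i y = 1 := by
  simp only [jointPMF]
  rw [← Fintype.prod_sum fun m y => f h m (A m) (i m) y]
  exact Finset.prod_eq_one fun m _ => (hf h m (A m) (i m)).2

lemma jointPMF_le_one {f : Channel d M} (hf : IsChannel f) (h : History d M) (A : Queries d M)
    (i : Fin M → Bool) (y : Responses M) : jointPMF f h A i y ≤ 1 := by
  rw [← sum_jointPMF hf h A i]
  exact Finset.single_le_sum (fun y _ => jointPMF_nonneg hf h A i y) (Finset.mem_univ y)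

lemma likelihood_eq_jointPMF_pattern (f : Channel d M) (h : History d M) (A : Queries d M)
    (y : Responses M) (x : Loc d) : likelihood f h A y x = jointPMF f h A (pattern A x) y := by
  refine Finset.prod_congr rfl fun m _ => ?_
  by_cases hx : x ∈ A m <;> simp [pattern, hx]

lemma sum_likelihood {f : Channel d M} (hf : IsChannel f) (h : History d M) (A : Queries d M)
    (x : Loc d) : ∑ y, likelihood f h A y x = 1 := by
  simp_rw [likelihood_eq_jointPMF_pattern, sum_jointPMF hf]

/-! ### Bayes' rule and entropy -/

/-- The function `L` is the conditional probability `L x` of some event given `X* = x`. -/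
structure IsLikelihood (L : Loc d → ℝ) : Prop where
  measurable : Measurable L
  nonneg : ∀ x, 0 ≤ L x
  le_one : ∀ x, L x ≤ 1

lemma isLikelihood_one : IsLikelihood fun _ : Loc d => 1 :=
  ⟨measurable_const, fun _ => zero_le_one, fun _ => le_rfl⟩

lemma IsLikelihood.mul {L L' : Loc d → ℝ} (hL : IsLikelihood L) (hL' : IsLikelihood L') :
    IsLikelihood fun x => L x * L' x where
  measurable := hL.measurable.mul hL'.measurable
  nonneg x := mul_nonneg (hL.nonneg x) (hL'.nonneg x)
  le_one x := mul_le_one₀ (hL.le_one x) (hL'.nonneg x) (hL'.le_one x)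

lemma isLikelihood_likelihood {f : Channel d M} (hf : IsChannel f) (h : History d M)
    {A : Queries d M} (hA : ∀ m, MeasurableSet (A m)) (y : Responses M) :
    IsLikelihood (likelihood f h A y) := by
  rw [funext (likelihood_eq_jointPMF_pattern f h A y)]
  exact ⟨(measurable_of_countable fun i => jointPMF f h A i y).comp (measurable_pattern hA),
    fun x => jointPMF_nonneg hf h A _ y, fun x => jointPMF_le_one hf h A _ y⟩

section Bayes

variable {p L L' : Loc d → ℝ}

lemma diffEntropy_eq_integral_negMulLog (p : Loc d → ℝ) :
    diffEntropy p = ∫ x, Real.negMulLog (p x) := by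
  simp only [diffEntropy, Real.negMulLog_eq_neg, integral_neg]

lemma IsLikelihood.integrable_mul (hL : IsLikelihood L) {q : Loc d → ℝ} (hq : Integrable q) :
    Integrable fun x => q x * L x :=
  hq.mul_bdd (c := 1) hL.measurable.aestronglyMeasurable <| .of_forall fun x => by
    rw [Real.norm_of_nonneg (hL.nonneg x)]
    exact hL.le_one x

lemma IsLikelihood.integrable_mul_negMulLog (hL : IsLikelihood L) {q : Loc d → ℝ}
    (hq : Integrable q) : Integrable fun x => q x * Real.negMulLog (L x) := by
  refine hq.mul_bdd (c := 1)
    (Real.continuous_negMulLog.measurable.comp hL.measurable).aestronglyMeasurable ?_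
  refine .of_forall fun x => ?_
  rw [Real.norm_of_nonneg (Real.negMulLog_nonneg (hL.nonneg x) (hL.le_one x))]
  exact (Real.negMulLog_le_one_sub_self (hL.nonneg x)).trans (sub_le_self 1 (hL.nonneg x))

lemma IsDensity.integrable_negMulLog (hp : IsDensity p) :
    Integrable fun x => Real.negMulLog (p x) := by
  simp only [Real.negMulLog_eq_neg]
  exact hp.integrable_entropy.neg

lemma IsDensity.integrable_negMulLog_mul (hp : IsDensity p) (hL : IsLikelihood L) :
    Integrable fun x => Real.negMulLog (p x * L x) := by
  simp only [Real.negMulLog_mul, mul_comm (L _)]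
  exact (hL.integrable_mul hp.integrable_negMulLog).add (hL.integrable_mul_negMulLog hp.integrable)

lemma IsDensity.evidence_nonneg (hp : IsDensity p) (hL : IsLikelihood L) : 0 ≤ evidence p L :=
  integral_nonneg fun x => mul_nonneg (hp.nonneg x) (hL.nonneg x)

lemma IsDensity.mul_ae_eq_zero (hp : IsDensity p) (hL : IsLikelihood L)
    (he : evidence p L = 0) : ∀ᵐ x, p x * L x = 0 :=
  (integral_eq_zero_iff_of_nonneg (fun x => mul_nonneg (hp.nonneg x) (hL.nonneg x))
    (hL.integrable_mul hp.integrable)).1 he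

lemma negMulLog_bayes (p L : Loc d → ℝ) (x : Loc d) :
    Real.negMulLog (bayes p L x) = (evidence p L)⁻¹ * Real.negMulLog (p x * L x)
      + p x * L x * Real.negMulLog (evidence p L)⁻¹ := by
  rw [bayes, div_eq_mul_inv, Real.negMulLog_mul]

lemma IsDensity.bayes (hp : IsDensity p) (hL : IsLikelihood L) (he : 0 < evidence p L) :
    IsDensity (bayes p L) where
  measurable := (hp.measurable.mul hL.measurable).div_const _
  nonneg x := div_nonneg (mul_nonneg (hp.nonneg x) (hL.nonneg x)) he.le
  integrable := (hL.integrable_mul hp.integrable).div_const _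
  integral_eq_one := (integral_div _ _).trans (div_self he.ne')
  integrable_entropy := by
    have hent : Integrable fun x => Real.negMulLog (TwentyQuestions.bayes p L x) := by
      simp only [negMulLog_bayes]
      exact ((hp.integrable_negMulLog_mul hL).const_mul _).add
        ((hL.integrable_mul hp.integrable).mul_const _)
    simpa [Real.negMulLog_eq_neg] using hent.neg

lemma IsDensity.evidence_mul_diffEntropy_bayes (hp : IsDensity p) (hL : IsLikelihood L) :
    evidence p L * diffEntropy (TwentyQuestions.bayes p L)
      = (∫ x, Real.negMulLog (p x * L x)) - Real.negMulLog (evidence p L) := by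
  by_cases he : evidence p L = 0
  · have hzero : ∫ x, Real.negMulLog (p x * L x) = 0 := integral_eq_zero_of_ae <| by
      filter_upwards [hp.mul_ae_eq_zero hL he] with x hx
      rw [hx, Real.negMulLog_zero, Pi.zero_apply]
    rw [hzero, he, zero_mul, Real.negMulLog_zero, sub_zero]
  · have hlog : evidence p L * Real.negMulLog (evidence p L)⁻¹ = Real.log (evidence p L) := by
      rw [Real.negMulLog, Real.log_inv]
      field_simp
    simp only [diffEntropy_eq_integral_negMulLog, negMulLog_bayes]
    rw [integral_add ((hp.integrable_negMulLog_mul hL).const_mul _)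
      ((hL.integrable_mul hp.integrable).mul_const _), integral_const_mul, integral_mul_const,
      ← evidence, mul_add, mul_inv_cancel_left₀ he, mul_left_comm, hlog, Real.negMulLog]
    ring

-- The two ways `H(X) + H(Y | X) = H(Y) + H(X | Y)` of expanding the joint entropy.
lemma IsDensity.diffEntropy_sub_sum_evidence_mul_diffEntropy_bayes {β : Type*} [Fintype β]
    {L : β → Loc d → ℝ} (hp : IsDensity p) (hL : ∀ y, IsLikelihood (L y))
    (hsum : ∀ x, ∑ y, L y x = 1) :
    diffEntropy p - ∑ y, evidence p (L y) * diffEntropy (TwentyQuestions.bayes p (L y))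
      = shannonEntropy (fun y => evidence p (L y))
        - ∫ x, p x * shannonEntropy fun y => L y x := by
  have hjoint : ∑ y, ∫ x, Real.negMulLog (p x * L y x)
      = diffEntropy p + ∫ x, p x * shannonEntropy fun y => L y x := by
    have hcond : Integrable fun x => p x * shannonEntropy fun y => L y x := by
      simp only [shannonEntropy_eq_sum_negMulLog, Finset.mul_sum]
      exact integrable_finsetSum _ fun y _ => (hL y).integrable_mul_negMulLog hp.integrable
    rw [← integral_finsetSum _ fun y _ => hp.integrable_negMulLog_mul (hL y),
      diffEntropy_eq_integral_negMulLog, ← integral_add hp.integrable_negMulLog hcond]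
    refine integral_congr_ae (.of_forall fun x => ?_)
    simp only [Real.negMulLog_mul, Finset.sum_add_distrib, ← Finset.sum_mul, ← Finset.mul_sum,
      hsum, one_mul, shannonEntropy_eq_sum_negMulLog]
  simp only [hp.evidence_mul_diffEntropy_bayes (hL _), Finset.sum_sub_distrib, hjoint,
    ← shannonEntropy_eq_sum_negMulLog]
  ring

lemma IsDensity.sum_evidence {β : Type*} [Fintype β] {L : β → Loc d → ℝ} (hp : IsDensity p)
    (hL : ∀ y, IsLikelihood (L y)) (hsum : ∀ x, ∑ y, L y x = 1) : ∑ y, evidence p (L y) = 1 := by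
  simp only [evidence]
  rw [← integral_finsetSum _ fun y _ => (hL y).integrable_mul hp.integrable]
  simp only [← Finset.mul_sum, hsum, mul_one, hp.integral_eq_one]

lemma evidence_bayes (p L L' : Loc d → ℝ) :
    evidence (bayes p L) L' = evidence p (fun x => L x * L' x) / evidence p L := by
  rw [evidence, evidence, ← integral_div]
  simp only [bayes, div_mul_eq_mul_div, mul_assoc]

lemma IsDensity.evidence_mul (hp : IsDensity p) (hL : IsLikelihood L) (L' : Loc d → ℝ) :
    evidence p (fun x => L x * L' x)
      = evidence p L * evidence (TwentyQuestions.bayes p L) L' := by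
  by_cases he : evidence p L = 0
  · rw [he, zero_mul]
    refine integral_eq_zero_of_ae ?_
    filter_upwards [hp.mul_ae_eq_zero hL he] with x hx
    rw [← mul_assoc, hx, zero_mul, Pi.zero_apply]
  · rw [evidence_bayes, mul_div_cancel₀ _ he]

lemma bayes_bayes (he : evidence p L ≠ 0) (L' : Loc d → ℝ) :
    bayes (bayes p L) L' = bayes p fun x => L x * L' x := by
  funext x
  simp only [bayes, evidence_bayes]
  rw [div_mul_eq_mul_div, div_div_div_cancel_right₀ he, mul_assoc]

end Bayes

/-! ### The expected entropy loss in one round -/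

section OneRound

variable {f : Channel d M} {p : Loc d → ℝ}

lemma evidence_likelihood (f : Channel d M) (h : History d M) (hp : Integrable p)
    {A : Queries d M} (hA : ∀ m, MeasurableSet (A m)) (y : Responses M) :
    evidence p (likelihood f h A y) = ∑ i, jointPMF f h A i y * cellProb p A i := by
  simp only [evidence, likelihood_eq_jointPMF_pattern]
  exact integral_mul_comp_pattern hA hp fun i => jointPMF f h A i y

theorem diffEntropy_sub_expectedNextEntropy (hf : IsChannel f) (h : History d M)
    (hp : IsDensity p) {A : Queries d M} (hA : ∀ m, MeasurableSet (A m)) :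
    diffEntropy p - expectedNextEntropy f h p A = gain f h p A := by
  have hcond : ∫ x, p x * shannonEntropy (fun y => likelihood f h A y x)
      = ∑ i, shannonEntropy (jointPMF f h A i) * cellProb p A i := by
    simp only [likelihood_eq_jointPMF_pattern]
    exact integral_mul_comp_pattern hA hp.integrable fun i => shannonEntropy (jointPMF f h A i)
  rw [expectedNextEntropy, hp.diffEntropy_sub_sum_evidence_mul_diffEntropy_bayes
    (isLikelihood_likelihood hf h hA) (sum_likelihood hf h A), hcond, gain_eq_mutualInfo,
    mutualInfo]
  simp only [evidence_likelihood f h hp.integrable hA]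

lemma gain_le_card (hf : IsChannel f) (h : History d M) (hp : IsDensity p) (A : Queries d M) :
    gain f h p A ≤ Fintype.card (Responses M) :=
  mutualInfo_le_card (jointPMF_nonneg hf h A) (jointPMF_le_one hf h A) (hp.cellProb_nonneg A)

variable {Q : ℕ → Fin M → Set (Set (Loc d))}

lemma nonempty_admissible (hne : ∀ n m, (Q n m).Nonempty) (n : ℕ) : Nonempty (Admissible Q n) :=
  ⟨⟨fun m => (hne n m).some, fun m => (hne n m).some_mem⟩⟩

lemma isLUB_maxGain (hf : IsChannel f) (hne : ∀ n m, (Q n m).Nonempty) (h : History d M)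
    (hp : IsDensity p) :
    IsLUB (Set.range fun A : Admissible Q h.length => gain f h p A.1) (maxGain Q f h p) := by
  have := nonempty_admissible hne h.length
  exact isLUB_ciSup ⟨_, Set.forall_mem_range.2 fun A => gain_le_card hf h hp A.1⟩

lemma exists_maxGain_sub_lt_gain (hf : IsChannel f) (hne : ∀ n m, (Q n m).Nonempty)
    (h : History d M) (hp : IsDensity p) {ε : ℝ} (hε : 0 < ε) :
    ∃ A : Admissible Q h.length, maxGain Q f h p - ε < gain f h p A.1 := by
  obtain ⟨_, ⟨A, rfl⟩, hA⟩ :=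
    (lt_isLUB_iff (isLUB_maxGain hf hne h hp)).1 (sub_lt_self _ hε)
  exact ⟨A, hA⟩

end OneRound

/-! ### Several rounds -/

section Paths

variable {Q : ℕ → Fin M → Set (Set (Loc d))} {f : Channel d M} {ζ : Policy Q} {h : History d M}
  {p : Loc d → ℝ}

lemma isLikelihood_pathLikelihood (hf : IsChannel f)
    (hQ : ∀ n m, ∀ A ∈ Q n m, MeasurableSet A) (ζ : Policy Q) (h : History d M)
    (ys : List (Responses M)) : IsLikelihood (pathLikelihood f ζ h ys) := by
  induction ys generalizing h with
  | nil => exact isLikelihood_one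
  | cons y ys ih =>
    exact (isLikelihood_likelihood hf h (fun m => hQ _ m _ ((ζ h).2 m)) y).mul (ih _)

lemma pathLikelihood_append_singleton (f : Channel d M) (ζ : Policy Q) (h : History d M)
    (ys : List (Responses M)) (y : Responses M) :
    pathLikelihood f ζ h (ys ++ [y]) = fun x => pathLikelihood f ζ h ys x *
      likelihood f (run ζ h ys) (ζ (run ζ h ys)).1 y x := by
  funext x
  induction ys generalizing h with
  | nil => simp [pathLikelihood, run]
  | cons z ys ih => simp only [List.cons_append, pathLikelihood, run, ih, mul_assoc]

lemma pathProb_nonneg (hf : IsChannel f) (hQ : ∀ n m, ∀ A ∈ Q n m, MeasurableSet A)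
    (ζ : Policy Q) (h : History d M) (hp : IsDensity p) (ys : List (Responses M)) :
    0 ≤ pathProb f ζ h p ys :=
  hp.evidence_nonneg (isLikelihood_pathLikelihood hf hQ ζ h ys)

lemma isDensity_posterior (hf : IsChannel f) (hQ : ∀ n m, ∀ A ∈ Q n m, MeasurableSet A)
    (hp : IsDensity p) {ys : List (Responses M)} (hys : 0 < pathProb f ζ h p ys) :
    IsDensity (posterior f ζ h p ys) :=
  hp.bayes (isLikelihood_pathLikelihood hf hQ ζ h ys) hys

lemma pathProb_nil (f : Channel d M) (ζ : Policy Q) (h : History d M) (hp : IsDensity p) :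
    pathProb f ζ h p [] = 1 := by
  simp [pathProb, evidence, pathLikelihood, hp.integral_eq_one]

lemma posterior_nil (f : Channel d M) (ζ : Policy Q) (h : History d M) (hp : IsDensity p) :
    posterior f ζ h p [] = p := by
  funext x
  rw [posterior, bayes, ← pathProb, pathProb_nil f ζ h hp, pathLikelihood, mul_one, div_one]

lemma pathProb_append_singleton (hf : IsChannel f) (hQ : ∀ n m, ∀ A ∈ Q n m, MeasurableSet A)
    (ζ : Policy Q) (h : History d M) (hp : IsDensity p) (ys : List (Responses M))
    (y : Responses M) :
    pathProb f ζ h p (ys ++ [y]) = pathProb f ζ h p ys * evidence (posterior f ζ h p ys)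
      (likelihood f (run ζ h ys) (ζ (run ζ h ys)).1 y) := by
  rw [pathProb, pathLikelihood_append_singleton,
    hp.evidence_mul (isLikelihood_pathLikelihood hf hQ ζ h ys), pathProb, posterior]

lemma posterior_append_singleton {ys : List (Responses M)} (hys : 0 < pathProb f ζ h p ys)
    (y : Responses M) :
    posterior f ζ h p (ys ++ [y]) = bayes (posterior f ζ h p ys)
      (likelihood f (run ζ h ys) (ζ (run ζ h ys)).1 y) := by
  rw [posterior, pathLikelihood_append_singleton, posterior, bayes_bayes hys.ne']

lemma sum_ofFn_succ {α β : Type*} [Fintype α] [AddCommMonoid β] (k : ℕ) (F : List α → β) :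
    ∑ ys : Fin (k + 1) → α, F (List.ofFn ys)
      = ∑ ys : Fin k → α, ∑ y, F (List.ofFn ys ++ [y]) := by
  rw [← (Fin.snocEquiv fun _ : Fin (k + 1) => α).sum_comp, Fintype.sum_prod_type_right]
  refine Finset.sum_congr rfl fun ys _ => Finset.sum_congr rfl fun y _ => ?_
  rw [List.ofFn_succ']
  simp [Fin.snocEquiv, List.concat_eq_append]

/-- The expectation of a function `F` of the next `k` responses under the policy `ζ`, starting from
the history `h` and the posterior `p`. -/
def pathExpectation (f : Channel d M) (ζ : Policy Q) (h : History d M) (p : Loc d → ℝ) (k : ℕ)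
    (F : List (Responses M) → ℝ) : ℝ :=
  ∑ ys : Fin k → Responses M, pathProb f ζ h p (List.ofFn ys) * F (List.ofFn ys)

lemma pathExpectation_zero (f : Channel d M) (ζ : Policy Q) (h : History d M) (hp : IsDensity p)
    (F : List (Responses M) → ℝ) : pathExpectation f ζ h p 0 F = F [] := by
  simp [pathExpectation, pathProb_nil f ζ h hp]

lemma pathExpectation_succ (hf : IsChannel f) (hQ : ∀ n m, ∀ A ∈ Q n m, MeasurableSet A)
    (ζ : Policy Q) (h : History d M) (hp : IsDensity p) (k : ℕ) (F : List (Responses M) → ℝ) :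
    pathExpectation f ζ h p (k + 1) F = pathExpectation f ζ h p k fun ys =>
      ∑ y, evidence (posterior f ζ h p ys) (likelihood f (run ζ h ys) (ζ (run ζ h ys)).1 y) *
        F (ys ++ [y]) := by
  rw [pathExpectation, sum_ofFn_succ k fun ys => pathProb f ζ h p ys * F ys]
  simp only [pathExpectation, pathProb_append_singleton hf hQ ζ h hp, Finset.mul_sum, mul_assoc]

lemma pathExpectation_sub (f : Channel d M) (ζ : Policy Q) (h : History d M) (p : Loc d → ℝ)
    (k : ℕ) (F F' : List (Responses M) → ℝ) :
    pathExpectation f ζ h p k (fun ys => F ys - F' ys)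
      = pathExpectation f ζ h p k F - pathExpectation f ζ h p k F' := by
  simp only [pathExpectation, mul_sub, Finset.sum_sub_distrib]

section Order

variable {k : ℕ} {F F' : List (Responses M) → ℝ}

lemma pathProb_mul_le_pathProb_mul (hf : IsChannel f)
    (hQ : ∀ n m, ∀ A ∈ Q n m, MeasurableSet A) (hp : IsDensity p)
    (hF : ∀ ys : List (Responses M), ys.length = k → 0 < pathProb f ζ h p ys → F ys ≤ F' ys)
    (ys : Fin k → Responses M) :
    pathProb f ζ h p (List.ofFn ys) * F (List.ofFn ys)
      ≤ pathProb f ζ h p (List.ofFn ys) * F' (List.ofFn ys) := by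
  rcases (pathProb_nonneg hf hQ ζ h hp (List.ofFn ys)).eq_or_lt with hzero | hpos
  · rw [← hzero, zero_mul, zero_mul]
  · exact mul_le_mul_of_nonneg_left (hF _ List.length_ofFn hpos) hpos.le

lemma pathExpectation_mono (hf : IsChannel f) (hQ : ∀ n m, ∀ A ∈ Q n m, MeasurableSet A)
    (hp : IsDensity p)
    (hF : ∀ ys : List (Responses M), ys.length = k → 0 < pathProb f ζ h p ys → F ys ≤ F' ys) :
    pathExpectation f ζ h p k F ≤ pathExpectation f ζ h p k F' :=
  Finset.sum_le_sum fun ys _ => pathProb_mul_le_pathProb_mul hf hQ hp hF ys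

lemma pathExpectation_eq_iff_of_le (hf : IsChannel f)
    (hQ : ∀ n m, ∀ A ∈ Q n m, MeasurableSet A) (hp : IsDensity p)
    (hF : ∀ ys : List (Responses M), ys.length = k → 0 < pathProb f ζ h p ys → F ys ≤ F' ys) :
    pathExpectation f ζ h p k F = pathExpectation f ζ h p k F' ↔
      ∀ ys : List (Responses M), ys.length = k → 0 < pathProb f ζ h p ys → F ys = F' ys := by
  rw [pathExpectation, pathExpectation, Finset.sum_eq_sum_iff_of_le fun ys _ =>
    pathProb_mul_le_pathProb_mul hf hQ hp hF ys]
  constructor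
  · rintro heq ys rfl hpos
    have hys := heq ys.get (Finset.mem_univ _)
    rw [List.ofFn_get] at hys
    exact mul_left_cancel₀ hpos.ne' hys
  · intro heq ys _
    rcases (pathProb_nonneg hf hQ ζ h hp (List.ofFn ys)).eq_or_lt with hzero | hpos
    · rw [← hzero, zero_mul, zero_mul]
    · rw [heq _ List.length_ofFn hpos]

lemma pathExpectation_congr (hf : IsChannel f) (hQ : ∀ n m, ∀ A ∈ Q n m, MeasurableSet A)
    (hp : IsDensity p)
    (hF : ∀ ys : List (Responses M), 0 < pathProb f ζ h p ys → F ys = F' ys) :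
    pathExpectation f ζ h p k F = pathExpectation f ζ h p k F' :=
  (pathExpectation_eq_iff_of_le hf hQ hp fun ys _ hpos => (hF ys hpos).le).2
    fun ys _ hpos => hF ys hpos

end Order

lemma pathExpectation_const (hf : IsChannel f) (hQ : ∀ n m, ∀ A ∈ Q n m, MeasurableSet A)
    (ζ : Policy Q) (h : History d M) (hp : IsDensity p) (k : ℕ) (c : ℝ) :
    pathExpectation f ζ h p k (fun _ => c) = c := by
  induction k with
  | zero => exact pathExpectation_zero f ζ h hp _
  | succ k ih =>
    rw [pathExpectation_succ hf hQ ζ h hp, ← ih]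
    refine pathExpectation_congr hf hQ hp fun ys hpos => ?_
    rw [← Finset.sum_mul, ih, (isDensity_posterior hf hQ hp hpos).sum_evidence
      (isLikelihood_likelihood hf _ fun m => hQ _ m _ ((ζ _).2 m)) (sum_likelihood hf _ _), one_mul]

/-- The gain of the queries that `ζ` chooses after the responses `ys`. -/
def pathGain (f : Channel d M) (ζ : Policy Q) (h : History d M) (p : Loc d → ℝ)
    (ys : List (Responses M)) : ℝ :=
  gain f (run ζ h ys) (posterior f ζ h p ys) (ζ (run ζ h ys)).1

/-- The expectation, given the history `h` and the posterior `p`, of the gain of the queries that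
`ζ` chooses `j` rounds later. -/
def expectedGain (f : Channel d M) (ζ : Policy Q) (h : History d M) (p : Loc d → ℝ) (j : ℕ) : ℝ :=
  pathExpectation f ζ h p j (pathGain f ζ h p)

lemma pathExpectation_succ_diffEntropy_posterior (hf : IsChannel f)
    (hQ : ∀ n m, ∀ A ∈ Q n m, MeasurableSet A) (ζ : Policy Q) (h : History d M)
    (hp : IsDensity p) (k : ℕ) :
    pathExpectation f ζ h p (k + 1) (fun ys => diffEntropy (posterior f ζ h p ys))
      = pathExpectation f ζ h p k (fun ys => diffEntropy (posterior f ζ h p ys))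
        - expectedGain f ζ h p k := by
  rw [pathExpectation_succ hf hQ ζ h hp, expectedGain, ← pathExpectation_sub]
  refine pathExpectation_congr hf hQ hp fun ys hpos => ?_
  simp only [posterior_append_singleton hpos, pathGain]
  rw [← diffEntropy_sub_expectedNextEntropy hf _ (isDensity_posterior hf hQ hp hpos)
    (fun m => hQ _ m _ ((ζ _).2 m)), sub_sub_cancel, expectedNextEntropy]

lemma expectedFinalEntropy_eq_sub_sum_expectedGain (hf : IsChannel f)
    (hQ : ∀ n m, ∀ A ∈ Q n m, MeasurableSet A) (ζ : Policy Q) (N : ℕ) (h : History d M)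
    (hp : IsDensity p) :
    expectedFinalEntropy f N h p ζ
      = diffEntropy p - ∑ j ∈ Finset.range (N - h.length), expectedGain f ζ h p j := by
  suffices ∀ k, pathExpectation f ζ h p k (fun ys => diffEntropy (posterior f ζ h p ys))
      = diffEntropy p - ∑ j ∈ Finset.range k, expectedGain f ζ h p j from this _
  intro k
  induction k with
  | zero => rw [pathExpectation_zero f ζ h hp, posterior_nil f ζ h hp, Finset.sum_range_zero,
      sub_zero]
  | succ k ih =>
    rw [pathExpectation_succ_diffEntropy_posterior hf hQ ζ h hp, ih, Finset.sum_range_succ,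
      sub_sub]

/-- The conditional probability, given `X* = x` and the history `h`, of the responses recorded in
the continuation `s` of `h`, when the queries are those recorded in `s`. It does not refer to a
policy, so that a policy can be defined by means of it. -/
def continuationLikelihood (f : Channel d M) : History d M → History d M → Loc d → ℝ
  | _, [], _ => 1
  | h, q :: s, x => likelihood f h q.1 q.2 x * continuationLikelihood f (h ++ [q]) s x

lemma exists_run_eq_append (f : Channel d M) (ζ : Policy Q) (h : History d M)
    (ys : List (Responses M)) :
    ∃ s, run ζ h ys = h ++ s ∧ pathLikelihood f ζ h ys = continuationLikelihood f h s := by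
  induction ys generalizing h with
  | nil => exact ⟨[], (List.append_nil h).symm, rfl⟩
  | cons y ys ih =>
    obtain ⟨s, hs, hL⟩ := ih (h ++ [((ζ h).1, y)])
    refine ⟨((ζ h).1, y) :: s, by simp [run, hs], funext fun x => ?_⟩
    rw [pathLikelihood, hL, continuationLikelihood]

lemma exists_policy_forall_posterior (hf : IsChannel f)
    (hQ : ∀ n m, ∀ A ∈ Q n m, MeasurableSet A) (h : History d M) (hp : IsDensity p)
    {r : (h' : History d M) → (Loc d → ℝ) → Admissible Q h'.length → Prop}
    (hr : ∀ h' p', IsDensity p' → ∃ A, r h' p' A) :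
    ∃ ζ : Policy Q, ∀ ys, 0 < pathProb f ζ h p ys →
      r (run ζ h ys) (posterior f ζ h p ys) (ζ (run ζ h ys)) := by
  have hr' : ∀ h' p', ∃ A, IsDensity p' → r h' p' A := fun h' p' => by
    by_cases hp' : IsDensity p'
    · exact (hr h' p' hp').imp fun A hA _ => hA
    · exact (hr h' p hp).imp fun A _ hc => absurd hc hp'
  choose S hS using hr'
  refine ⟨fun h' => S h' (bayes p (continuationLikelihood f h (h'.drop h.length))), ?_⟩
  set ζ : Policy Q := fun h' => S h' (bayes p (continuationLikelihood f h (h'.drop h.length)))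
  intro ys hpos
  obtain ⟨s, hs, hL⟩ := exists_run_eq_append f ζ h ys
  have hpost : bayes p (continuationLikelihood f h ((run ζ h ys).drop h.length))
      = posterior f ζ h p ys := by
    rw [posterior, hL, hs, List.drop_left]
  have hζ : ζ (run ζ h ys) = S (run ζ h ys) (posterior f ζ h p ys) :=
    congrArg (S (run ζ h ys)) hpost
  rw [hζ]
  exact hS _ _ (isDensity_posterior hf hQ hp hpos)

end Paths

/-! ### The value function -/

section Value

variable {Q : ℕ → Fin M → Set (Set (Loc d))} {f : Channel d M} {N : ℕ} {h : History d M}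
  {p : Loc d → ℝ} {G : ℝ}

/-- In every situation that can arise before round `N`, starting from the history `h` and the
posterior `p`, the maximal one-step entropy loss is `G`. -/
def HasConstMaxGain (Q : ℕ → Fin M → Set (Set (Loc d))) (f : Channel d M) (N : ℕ)
    (h : History d M) (p : Loc d → ℝ) (G : ℝ) : Prop :=
  ∀ (ζ : Policy Q) (ys : List (Responses M)), h.length + ys.length < N →
    0 < pathProb f ζ h p ys → maxGain Q f (run ζ h ys) (posterior f ζ h p ys) = G

lemma HasConstMaxGain.pathGain_le (hG : HasConstMaxGain Q f N h p G)
    (hf : IsChannel f) (hne : ∀ n m, (Q n m).Nonempty)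
    (hQ : ∀ n m, ∀ A ∈ Q n m, MeasurableSet A) (hp : IsDensity p)
    {ζ : Policy Q} {ys : List (Responses M)}
    (hys : h.length + ys.length < N) (hpos : 0 < pathProb f ζ h p ys) :
    pathGain f ζ h p ys ≤ G := by
  rw [← hG ζ ys hys hpos]
  exact (isLUB_maxGain hf hne _ (isDensity_posterior hf hQ hp hpos)).1 (Set.mem_range_self _)

lemma HasConstMaxGain.expectedGain_le (hG : HasConstMaxGain Q f N h p G)
    (hf : IsChannel f) (hne : ∀ n m, (Q n m).Nonempty)
    (hQ : ∀ n m, ∀ A ∈ Q n m, MeasurableSet A) (hp : IsDensity p)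
    (ζ : Policy Q) {j : ℕ} (hj : h.length + j < N) :
    expectedGain f ζ h p j ≤ G := by
  rw [← pathExpectation_const hf hQ ζ h hp j G]
  exact pathExpectation_mono hf hQ hp fun ys hys hpos =>
    hG.pathGain_le hf hne hQ hp (hys ▸ hj) hpos

lemma HasConstMaxGain.expectedGain_eq_iff (hG : HasConstMaxGain Q f N h p G)
    (hf : IsChannel f) (hne : ∀ n m, (Q n m).Nonempty)
    (hQ : ∀ n m, ∀ A ∈ Q n m, MeasurableSet A) (hp : IsDensity p)
    (ζ : Policy Q) {j : ℕ} (hj : h.length + j < N) :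
    expectedGain f ζ h p j = G ↔ ∀ ys : List (Responses M), ys.length = j →
      0 < pathProb f ζ h p ys → pathGain f ζ h p ys = G := by
  conv_lhs => rw [← pathExpectation_const hf hQ ζ h hp j G]
  exact pathExpectation_eq_iff_of_le hf hQ hp fun ys hys hpos =>
    hG.pathGain_le hf hne hQ hp (hys ▸ hj) hpos

lemma HasConstMaxGain.isGreedy_iff (hG : HasConstMaxGain Q f N h p G)
    (hf : IsChannel f) (hne : ∀ n m, (Q n m).Nonempty)
    (hQ : ∀ n m, ∀ A ∈ Q n m, MeasurableSet A) (hp : IsDensity p) (ζ : Policy Q) :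
    IsGreedy f N h p ζ ↔ ∀ j, h.length + j < N → expectedGain f ζ h p j = G := by
  constructor
  · intro hgreedy j hj
    refine (hG.expectedGain_eq_iff hf hne hQ hp ζ hj).2 fun ys hys hpos => ?_
    have hlt : h.length + ys.length < N := hys ▸ hj
    exact (hgreedy ys hlt hpos).trans (hG ζ ys hlt hpos)
  · intro heq ys hys hpos
    rw [hG ζ ys hys hpos]
    exact (hG.expectedGain_eq_iff hf hne hQ hp ζ hys).1 (heq _ hys) ys rfl hpos

lemma sum_range_sub_const {n N : ℕ} (hn : n ≤ N) (c : ℝ) :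
    ∑ _j ∈ Finset.range (N - n), c = ((N : ℝ) - n) * c := by
  rw [Finset.sum_const, Finset.card_range, nsmul_eq_mul, Nat.cast_sub hn]

lemma HasConstMaxGain.le_expectedFinalEntropy (hG : HasConstMaxGain Q f N h p G)
    (hf : IsChannel f) (hne : ∀ n m, (Q n m).Nonempty)
    (hQ : ∀ n m, ∀ A ∈ Q n m, MeasurableSet A) (hp : IsDensity p) (hN : h.length ≤ N)
    (ζ : Policy Q) :
    diffEntropy p - ((N : ℝ) - h.length) * G ≤ expectedFinalEntropy f N h p ζ := by
  rw [expectedFinalEntropy_eq_sub_sum_expectedGain hf hQ ζ N h hp, ← sum_range_sub_const hN]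
  exact sub_le_sub_left (Finset.sum_le_sum fun j hj =>
    hG.expectedGain_le hf hne hQ hp ζ (Nat.add_lt_of_lt_sub' (Finset.mem_range.1 hj))) _

lemma HasConstMaxGain.expectedFinalEntropy_eq_iff_isGreedy (hG : HasConstMaxGain Q f N h p G)
    (hf : IsChannel f) (hne : ∀ n m, (Q n m).Nonempty)
    (hQ : ∀ n m, ∀ A ∈ Q n m, MeasurableSet A) (hp : IsDensity p) (hN : h.length ≤ N)
    (ζ : Policy Q) :
    expectedFinalEntropy f N h p ζ = diffEntropy p - ((N : ℝ) - h.length) * G ↔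
      IsGreedy f N h p ζ := by
  rw [expectedFinalEntropy_eq_sub_sum_expectedGain hf hQ ζ N h hp, ← sum_range_sub_const hN,
    sub_right_inj, Finset.sum_eq_sum_iff_of_le fun j hj =>
      hG.expectedGain_le hf hne hQ hp ζ (Nat.add_lt_of_lt_sub' (Finset.mem_range.1 hj)),
    hG.isGreedy_iff hf hne hQ hp]
  simp only [Finset.mem_range, Nat.lt_sub_iff_add_lt']

lemma HasConstMaxGain.exists_expectedFinalEntropy_lt (hG : HasConstMaxGain Q f N h p G)
    (hf : IsChannel f) (hne : ∀ n m, (Q n m).Nonempty)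
    (hQ : ∀ n m, ∀ A ∈ Q n m, MeasurableSet A) (hp : IsDensity p) (hN : h.length ≤ N) {b : ℝ}
    (hb : diffEntropy p - ((N : ℝ) - h.length) * G < b) :
    ∃ ζ : Policy Q, expectedFinalEntropy f N h p ζ < b := by
  obtain ⟨ε, hε, hεb⟩ := exists_pos_mul_lt (sub_pos.2 hb) ((N : ℝ) - h.length)
  obtain ⟨ζ, hζ⟩ := exists_policy_forall_posterior hf hQ h hp
    fun h' p' hp' => exists_maxGain_sub_lt_gain hf hne h' hp' hε
  have hgain : ∀ j ∈ Finset.range (N - h.length), G - ε ≤ expectedGain f ζ h p j := by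
    intro j hj
    rw [← pathExpectation_const hf hQ ζ h hp j (G - ε)]
    refine pathExpectation_mono hf hQ hp fun ys hys hpos => ?_
    rw [← hG ζ ys (hys ▸ Nat.add_lt_of_lt_sub' (Finset.mem_range.1 hj)) hpos]
    exact (hζ ys hpos).le
  refine ⟨ζ, ?_⟩
  calc expectedFinalEntropy f N h p ζ
      = diffEntropy p - ∑ j ∈ Finset.range (N - h.length), expectedGain f ζ h p j :=
        expectedFinalEntropy_eq_sub_sum_expectedGain hf hQ ζ N h hp
    _ ≤ diffEntropy p - ∑ _j ∈ Finset.range (N - h.length), (G - ε) :=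
        sub_le_sub_left (Finset.sum_le_sum hgain) _
    _ = diffEntropy p - ((N : ℝ) - h.length) * G + ((N : ℝ) - h.length) * ε := by
        rw [sum_range_sub_const hN]
        ring
    _ < b := by linarith

lemma HasConstMaxGain.isGLB_expectedFinalEntropy (hG : HasConstMaxGain Q f N h p G)
    (hf : IsChannel f) (hne : ∀ n m, (Q n m).Nonempty)
    (hQ : ∀ n m, ∀ A ∈ Q n m, MeasurableSet A) (hp : IsDensity p) (hN : h.length ≤ N) :
    IsGLB (Set.range fun ζ : Policy Q => expectedFinalEntropy f N h p ζ)
      (diffEntropy p - ((N : ℝ) - h.length) * G) := by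
  refine ⟨Set.forall_mem_range.2 (hG.le_expectedFinalEntropy hf hne hQ hp hN), fun b hb => ?_⟩
  refine not_lt.1 fun hlt => ?_
  obtain ⟨ζ, hζ⟩ := hG.exists_expectedFinalEntropy_lt hf hne hQ hp hN hlt
  exact hζ.not_ge (hb (Set.mem_range_self ζ))

lemma HasConstMaxGain.value_eq (hG : HasConstMaxGain Q f N h p G)
    (hf : IsChannel f) (hne : ∀ n m, (Q n m).Nonempty)
    (hQ : ∀ n m, ∀ A ∈ Q n m, MeasurableSet A) (hp : IsDensity p) (hN : h.length ≤ N) :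
    value Q f N h p = diffEntropy p - ((N : ℝ) - h.length) * G := by
  have : Nonempty (Policy Q) := ⟨fun h' => (nonempty_admissible hne h'.length).some⟩
  exact (hG.isGLB_expectedFinalEntropy hf hne hQ hp hN).ciInf_eq

lemma HasConstMaxGain.isGLB_value (hG : HasConstMaxGain Q f N h p G)
    (hf : IsChannel f) (hne : ∀ n m, (Q n m).Nonempty)
    (hQ : ∀ n m, ∀ A ∈ Q n m, MeasurableSet A) (hp : IsDensity p) (hN : h.length ≤ N) :
    IsGLB (Set.range fun ζ : Policy Q => expectedFinalEntropy f N h p ζ) (value Q f N h p) := by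
  rw [hG.value_eq hf hne hQ hp hN]
  exact hG.isGLB_expectedFinalEntropy hf hne hQ hp hN

lemma isOptimal_iff_eq_of_isGLB {V : ℝ} {ζ : Policy Q}
    (hV : IsGLB (Set.range fun ζ' : Policy Q => expectedFinalEntropy f N h p ζ') V) :
    IsOptimal f N h p ζ ↔ expectedFinalEntropy f N h p ζ = V := by
  refine ⟨fun hopt => ?_, fun heq ζ' => heq.trans_le (hV.1 (Set.mem_range_self ζ'))⟩
  exact le_antisymm (hV.2 (Set.forall_mem_range.2 hopt)) (hV.1 (Set.mem_range_self ζ))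

lemma HasConstMaxGain.isOptimal_iff_isGreedy (hG : HasConstMaxGain Q f N h p G)
    (hf : IsChannel f) (hne : ∀ n m, (Q n m).Nonempty)
    (hQ : ∀ n m, ∀ A ∈ Q n m, MeasurableSet A) (hp : IsDensity p) (hN : h.length ≤ N)
    (ζ : Policy Q) : IsOptimal f N h p ζ ↔ IsGreedy f N h p ζ :=
  (isOptimal_iff_eq_of_isGLB (hG.isGLB_expectedFinalEntropy hf hne hQ hp hN)).trans
    (hG.expectedFinalEntropy_eq_iff_isGreedy hf hne hQ hp hN ζ)

lemma exists_isGreedy (hf : IsChannel f) (hQ : ∀ n m, ∀ A ∈ Q n m, MeasurableSet A)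
    (hp : IsDensity p) (N : ℕ) (h : History d M)
    (hatt : ∀ (h' : History d M) (p' : Loc d → ℝ), IsDensity p' →
      ∃ A : Admissible Q h'.length, gain f h' p' A.1 = maxGain Q f h' p') :
    ∃ ζ : Policy Q, IsGreedy f N h p ζ :=
  (exists_policy_forall_posterior hf hQ h hp hatt).imp fun _ hζ ys _ hpos => hζ ys hpos

end Value

/-! ### Memoryless channels -/

section Memoryless

variable {Q : ℕ → Fin M → Set (Set (Loc d))} {f : Channel d M}

lemma jointPMF_eq_of_isMemoryless (hf : IsMemoryless f) (h h' : History d M)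
    (A A' : Queries d M) : jointPMF f h A = jointPMF f h' A' := by
  funext i y
  exact Finset.prod_congr rfl fun m _ => by rw [hf h h' m (A m) (A' m)]

/-- The capacity of the joint channel of the players when `f` is memoryless. The history and the
queries at which `f` is evaluated are then arbitrary. -/
def jointCapacity (f : Channel d M) : ℝ := capacity (jointPMF f [] fun _ => ∅)

lemma isGreatest_gain_jointCapacity (hd : 0 < d) (hf : IsMemoryless f)
    (hQ : ∀ n m, Q n m = {A | MeasurableSet A}) (h : History d M) {p : Loc d → ℝ}
    (hp : IsDensity p) :
    IsGreatest (Set.range fun A : Admissible Q h.length => gain f h p A.1) (jointCapacity f) := by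
  have hgain : ∀ A, gain f h p A = mutualInfo (jointPMF f [] fun _ => ∅) (cellProb p A) :=
    fun A => by rw [gain_eq_mutualInfo, jointPMF_eq_of_isMemoryless hf h [] A fun _ => ∅]
  constructor
  · obtain ⟨u, hu, hmax⟩ := exists_mutualInfo_eq_capacity (jointPMF f [] fun _ => ∅)
    obtain ⟨A, hA, rfl⟩ := hp.exists_cellProb_eq hd hu
    exact ⟨⟨A, fun m => (hQ _ m).symm ▸ hA m⟩, (hgain A).trans hmax⟩
  · rintro _ ⟨A, rfl⟩
    have hA : ∀ m, MeasurableSet (A.1 m) := fun m => (hQ h.length m).subset (A.2 m)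
    exact (hgain A.1).trans_le (mutualInfo_le_capacity _ (hp.cellProb_mem_stdSimplex hA))

lemma maxGain_eq_jointCapacity (hd : 0 < d) (hf : IsMemoryless f)
    (hQ : ∀ n m, Q n m = {A | MeasurableSet A}) (h : History d M) {p : Loc d → ℝ}
    (hp : IsDensity p) : maxGain Q f h p = jointCapacity f :=
  (isGreatest_gain_jointCapacity hd hf hQ h hp).csSup_eq

end Memoryless

end TwentyQuestions

end

theorem theorem1 {d M : ℕ} (hd : 0 < d) (N : ℕ)
    (f : Channel d M) (hf : IsChannel f) :
    -- general conditional channels and general classes of measurable query regions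
    (∀ Q : ℕ → Fin M → Set (Set (Loc d)),
      (∀ n m, (Q n m).Nonempty) → (∀ n m, ∀ A ∈ Q n m, MeasurableSet A) →
      ∀ (h : History d M) (p : Loc d → ℝ),
        IsDensity p →
        -- the expected one-step entropy loss, and its supremum over the queries
        (∀ A : Admissible Q h.length,
          diffEntropy p - expectedNextEntropy f h p A.1
            = gain f h p A.1) ∧
        IsLUB (Set.range fun A : Admissible Q h.length =>
            diffEntropy p - expectedNextEntropy f h p A.1)
          (maxGain Q f h p) ∧
        -- if the maximal loss is the same number `G` at all the remaining steps, then it gives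
        -- the value function, and the optimal policies are the greedy ones
        ∀ G : ℝ, h.length ≤ N →
          (∀ (ζ : Policy Q) (ys : List (Responses M)),
            h.length + ys.length < N → 0 < pathProb f ζ h p ys →
            maxGain Q f (run ζ h ys)
              (posterior f ζ h p ys) = G) →
          IsGLB (Set.range fun ζ : Policy Q =>
              expectedFinalEntropy f N h p ζ) (value Q f N h p) ∧
          value Q f N h p
            = diffEntropy p - ((N : ℝ) - h.length) * G ∧
          ∀ ζ : Policy Q,
            IsOptimal f N h p ζ ↔ IsGreedy f N h p ζ) ∧
    -- memoryless channels, all measurable query regions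
    (IsMemoryless f →
      ∀ Q : ℕ → Fin M → Set (Set (Loc d)),
        (∀ n m, Q n m = {A | MeasurableSet A}) →
        ∃ G : ℝ, ∀ (h : History d M) (p : Loc d → ℝ),
          IsDensity p →
          maxGain Q f h p = G ∧
          (∃ A : Admissible Q h.length, gain f h p A.1 = G) ∧
          (h.length ≤ N →
            IsGLB (Set.range fun ζ : Policy Q =>
                expectedFinalEntropy f N h p ζ)
              (value Q f N h p) ∧
            value Q f N h p
              = diffEntropy p - ((N : ℝ) - h.length) * G ∧
            (∃ ζ : Policy Q, IsOptimal f N h p ζ) ∧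
            ∀ ζ : Policy Q,
              IsOptimal f N h p ζ ↔ IsGreedy f N h p ζ)) := by
  refine ⟨fun Q hne hQ h p hp => ?_, fun hmem Q hQ => ⟨jointCapacity f, fun h p hp => ?_⟩⟩
  · have hloss : ∀ A : Admissible Q h.length,
        diffEntropy p - expectedNextEntropy f h p A.1 = gain f h p A.1 := fun A =>
      diffEntropy_sub_expectedNextEntropy hf h hp fun m => hQ _ m _ (A.2 m)
    refine ⟨hloss, ?_, fun G hN (hG : HasConstMaxGain Q f N h p G) =>
      ⟨hG.isGLB_value hf hne hQ hp hN, hG.value_eq hf hne hQ hp hN,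
        hG.isOptimal_iff_isGreedy hf hne hQ hp hN⟩⟩
    simpa only [hloss] using isLUB_maxGain hf hne h hp
  · have hne : ∀ n m, (Q n m).Nonempty := fun n m =>
      ⟨∅, (hQ n m).superset (Set.mem_ofPred.2 .empty)⟩
    have hmeas : ∀ n m, ∀ A ∈ Q n m, MeasurableSet A := fun n m A hA => (hQ n m).subset hA
    have hmax := fun h p (hp : IsDensity p) => maxGain_eq_jointCapacity hd hmem hQ h hp
    have hatt := fun h p (hp : IsDensity p) => (isGreatest_gain_jointCapacity hd hmem hQ h hp).1
    have hG : HasConstMaxGain Q f N h p (jointCapacity f) := fun ζ ys _ hpos =>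
      hmax _ _ (isDensity_posterior hf hmeas hp hpos)
    obtain ⟨ζ, hζ⟩ := exists_isGreedy hf hmeas hp N h fun h' p' hp' =>
      (hmax h' p' hp').symm ▸ hatt h' p' hp'
    exact ⟨hmax h p hp, hatt h p hp, fun hN =>
      ⟨hG.isGLB_value hf hne hmeas hp hN, hG.value_eq hf hne hmeas hp hN,
        ⟨ζ, (hG.isOptimal_iff_isGreedy hf hne hmeas hp hN ζ).2 hζ⟩,
        hG.isOptimal_iff_isGreedy hf hne hmeas hp hN⟩⟩
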